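/- Let $\mathcal{G}$ be a locally coherent Grothendieck category, i.e. a Grothendieck category with a set of finitely presented generators in which the class $fp(\mathcal{G})$ of finitely presented objects is closed under kernels. Let $\mathbf{t}=(\mathcal{T},\mathcal{F})$ be a torsion pair in $\mathcal{G}$, and for each object $X$ let $t(X)$ denote its torsion part, so that there is an exact sequence $0\to t(X)\to X\to X/t(X)\to 0$ with $t(X)\in\mathcal{T}$ and $X/t(X)\in\mathcal{F}$. Let $(\mathcal{U}_{\mathbf{t}},\mathcal{V}_{\mathbf{t}})$, where $$\mathcal{U}_{\mathbf{t}}=\{U\in\mathcal{D}^{\leq 0}(\mathcal{G}) : H^0(U)\in\mathcal{T}\},\qquad \mathcal{V}_{\mathbf{t}}=\mathcal{U}_{\mathbf{t}}^{\perp}[1]=\{V\in\mathcal{D}^{\geq -1}(\mathcal{G}) : H^{-1}(V)\in\mathcal{F}\},$$ be the associated Happel-Reiten-Smalø t-structure in the unbounded derived category $\mathcal{D}(\mathcal{G})$. Regard $\mathcal{D}^b(fp(\mathcal{G}))$ as the full triangulated subcategory of $\mathcal{D}(\mathcal{G})$ consisting of the complexes $M$ such that $H^i(M)=0$ for $|i|\gg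 0$ and $H^i(M)\in fp(\mathcal{G})$ for all $i\in\mathbb{Z}$. The following assertions are equivalent: 1. The t-structure $(\mathcal{U}_{\mathbf{t}},\mathcal{V}_{\mathbf{t}})$ restricts to $\mathcal{D}^b(fp(\mathcal{G}))$, i.e. $(\mathcal{U}_{\mathbf{t}}\cap\mathcal{D}^b(fp(\mathcal{G})),\mathcal{V}_{\mathbf{t}}\cap\mathcal{D}^b(fp(\mathcal{G})))$ is a t-structure in $\mathcal{D}^b(fp(\mathcal{G}))$; equivalently, the truncation triangle of each object of $\mathcal{D}^b(fp(\mathcal{G}))$ has its three vertices in $\mathcal{D}^b(fp(\mathcal{G}))$. 2. The torsion pair $\mathbf{t}$ restricts to $fp(\mathcal{G})$, i.e. $t(X)\in fp(\mathcal{G})$ for every $X\in fp(\mathcal{G})$. In particular, if $\mathcal{G}$ is moreover locally noetherian (it has a set of noetherian generators), then $(\mathcal{U}_{\mathbf{t}},\mathcal{V}_{\mathbf{t}})$ restricts to $\mathcal{D}^b(fp(\mathcal{G}))$. -/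

import Mathlib

open CategoryTheory CategoryTheory.Limits ZeroObject CategoryTheory.Pretriangulated CategoryTheory.Triangulated

universe w v u

/-- A torsion pair `(T, F)` in an abelian category: two (strictly) full subcategories such that
`Hom(T, F) = 0` and every object `X` fits into a short exact sequence `0 ⟶ T_X ⟶ X ⟶ F_X ⟶ 0`
with `T_X` in `T` and `F_X` in `F`. -/
structure TorsionPair (A : Type u) [Category.{v} A] [Abelian A] where
  /-- the torsion class -/
  torsion : ObjectProperty A
  /-- the torsion-free class -/
  torsionFree : ObjectProperty A
  torsion_iso : torsion.IsClosedUnderIsomorphisms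
  torsionFree_iso : torsionFree.IsClosedUnderIsomorphisms
  hom_eq_zero {X Y : A} (f : X ⟶ Y) : torsion X → torsionFree Y → f = 0
  exists_shortExact (X : A) : ∃ (T F : A) (i : T ⟶ X) (p : X ⟶ F) (w : i ≫ p = 0),
    torsion T ∧ torsionFree F ∧ (ShortComplex.mk i p w).ShortExact

namespace TorsionPair

attribute [instance] torsion_iso torsionFree_iso

section

variable {A : Type u} [Category.{v} A] [Abelian A] (t : TorsionPair A)

/-- The torsion part `t(X)` of `X` (well defined up to a unique isomorphism over `X`). -/
noncomputable def radical (X : A) : A := (t.exists_shortExact X).choose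

/-- The torsion pair `t` restricts to the finitely presented objects: `t(X)` is finitely
presented for every finitely presented object `X`. -/
def RestrictsToFP : Prop :=
  ∀ X : A, IsFinitelyPresentable.{v} X → IsFinitelyPresentable.{v} (t.radical X)

lemma torsion_of_isZero {X : A} (hX : IsZero X) : t.torsion X := by
  obtain ⟨T, F, i, p, w, hT, -, h⟩ := t.exists_shortExact X
  have : Mono i := h.mono_f
  exact t.torsion.prop_of_iso ((IsZero.of_mono i hX).iso hX) hT

lemma torsionFree_of_isZero {X : A} (hX : IsZero X) : t.torsionFree X := by
  obtain ⟨T, F, i, p, w, -, hF, h⟩ := t.exists_shortExact X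
  have : Epi p := h.epi_g
  exact t.torsionFree.prop_of_iso ((IsZero.of_epi p hX).iso hX) hF

end

end TorsionPair

namespace DerivedCategory

variable {A : Type u} [Category.{v} A] [Abelian A] [HasDerivedCategory.{w} A]

lemma mono_homologyMap_mor₁ (T : Triangle (DerivedCategory A)) (hT : T ∈ distTriang _) (m n : ℤ)
    (hmn : m + 1 = n) (h : IsZero ((homologyFunctor A m).obj T.obj₃)) :
    Mono ((homologyFunctor A n).map T.mor₁) :=
  (HomologySequence.mono_homologyMap_mor₁_iff T hT m n hmn).2 (h.eq_of_src _ _)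

lemma epi_homologyMap_mor₁ (T : Triangle (DerivedCategory A)) (hT : T ∈ distTriang _) (n : ℤ)
    (h : IsZero ((homologyFunctor A n).obj T.obj₃)) :
    Epi ((homologyFunctor A n).map T.mor₁) :=
  (HomologySequence.epi_homologyMap_mor₁_iff T hT n).2 (h.eq_of_tgt _ _)

lemma mono_homologyMap_mor₂ (T : Triangle (DerivedCategory A)) (hT : T ∈ distTriang _) (n : ℤ)
    (h : IsZero ((homologyFunctor A n).obj T.obj₁)) :
    Mono ((homologyFunctor A n).map T.mor₂) :=
  (HomologySequence.mono_homologyMap_mor₂_iff T hT n).2 (h.eq_of_src _ _)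

lemma epi_homologyMap_mor₂ (T : Triangle (DerivedCategory A)) (hT : T ∈ distTriang _) (m n : ℤ)
    (hmn : m + 1 = n) (h : IsZero ((homologyFunctor A n).obj T.obj₁)) :
    Epi ((homologyFunctor A m).map T.mor₂) :=
  (HomologySequence.epi_homologyMap_mor₂_iff T hT m n hmn).2 (h.eq_of_tgt _ _)

/-- The isomorphism `Hⁿ'(X[a]) ≅ Hⁿ(X)` when `a + n' = n`. -/
noncomputable def homologyShiftIso (X : DerivedCategory A) (n a n' : ℤ) (h : a + n' = n) :
    (homologyFunctor A n').obj (X⟦a⟧) ≅ (homologyFunctor A n).obj X :=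
  ((homologyFunctor A 0).shiftIso a n' n h).app X

/-- A morphism from an object in `D^{≤ 0}` to an object in `D^{≥ 0}` is zero as soon as it
induces the zero morphism on `H⁰`. -/
lemma eq_zero_of_homologyMap_eq_zero {X Y : DerivedCategory A} (f : X ⟶ Y)
    (hX : X.IsLE 0) (hY : Y.IsGE 0) (hf : (homologyFunctor A 0).map f = 0) : f = 0 := by
  let t : TStructure (DerivedCategory A) := TStructure.t
  obtain ⟨f', rfl⟩ := t.liftTruncLE_aux f 0
  have : t.IsGE ((t.truncLE 0).obj Y) 0 := inferInstance
  obtain ⟨f'', rfl⟩ := t.descTruncGT_aux f' (-1) 0 (by lia)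
  have h₁ : IsLE ((t.truncLE (-1)).obj X) (-1) := inferInstanceAs (t.IsLE _ _)
  have h₂ : IsGE ((t.truncGT 0).obj Y) 1 := t.isGE_truncGT_obj _ _ _
  have h₃ : IsLE ((t.truncGT (-1)).obj X) 0 := inferInstanceAs (t.IsLE _ _)
  have h₄ : IsGE ((t.truncGT (-1)).obj X) 0 := t.isGE_truncGT_obj _ _ _
  have h₅ : IsLE ((t.truncLE 0).obj Y) 0 := inferInstanceAs (t.IsLE _ _)
  have h₆ : IsGE ((t.truncLE 0).obj Y) 0 := this
  have e₁ : Epi ((homologyFunctor A 0).map ((t.truncGTπ (-1)).app X)) :=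
    epi_homologyMap_mor₂ _ (t.triangleLEGT_distinguished (-1) X) 0 1 rfl
      (isZero_of_isLE _ (-1) 1 (by lia) (hX := h₁))
  have e₂ : Mono ((homologyFunctor A 0).map ((t.truncLEι 0).app Y)) :=
    mono_homologyMap_mor₁ _ (t.triangleLEGT_distinguished 0 Y) (-1) 0 rfl
      (isZero_of_isGE _ 1 (-1) (by lia) (hX := h₂))
  have h : (homologyFunctor A 0).map f'' = 0 := by
    rw [Functor.map_comp, Functor.map_comp] at hf
    rw [← cancel_epi ((homologyFunctor A 0).map ((t.truncGTπ (-1)).app X)),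
      ← cancel_mono ((homologyFunctor A 0).map ((t.truncLEι 0).app Y)), hf]
    simp
  obtain ⟨B, ⟨e⟩⟩ := exists_iso_singleFunctor_obj_of_isGE_of_isLE ((t.truncGT (-1)).obj X) 0
  obtain ⟨C, ⟨e'⟩⟩ := exists_iso_singleFunctor_obj_of_isGE_of_isLE ((t.truncLE 0).obj Y) 0
  obtain ⟨g, hg⟩ := (singleFunctor A 0).map_surjective (e.inv ≫ f'' ≫ e'.hom)
  have hg₀ : g = 0 := by
    have := NatIso.naturality_1 (singleFunctorCompHomologyFunctorIso A 0) g
    rw [← Functor.id_map g, ← this, Functor.comp_map, hg]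
    simp [h]
  have : f'' = 0 := by
    rw [hg₀, Functor.map_zero] at hg
    rw [← cancel_epi e.inv, ← cancel_mono e'.hom, Category.assoc, ← hg]
    simp
  simp [this]

end DerivedCategory

namespace TorsionPair

open DerivedCategory

variable {A : Type u} [Category.{v} A] [Abelian A] [HasDerivedCategory.{w} A] (t : TorsionPair A)

/-- The (shifted) aisle `U_t[-n]`: the objects `X` of `D^{≤ n}` such that `Hⁿ(X)` is torsion. -/
def hrsLE (n : ℤ) : ObjectProperty (DerivedCategory A) := fun X ↦
  X.IsLE n ∧ t.torsion ((homologyFunctor A n).obj X)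

/-- `V_t[-n]`: the objects `X` of `D^{≥ n - 1}` such that `Hⁿ⁻¹(X)` is torsion-free. -/
def hrsGE (n : ℤ) : ObjectProperty (DerivedCategory A) := fun X ↦
  X.IsGE (n - 1) ∧ t.torsionFree ((homologyFunctor A (n - 1)).obj X)

lemma hrs_exists_triangle (M : DerivedCategory A) :
    ∃ (X Y : DerivedCategory A) (_ : t.hrsLE 0 X) (_ : t.hrsGE 1 Y)
      (f : X ⟶ M) (g : M ⟶ Y) (h : Y ⟶ X⟦(1 : ℤ)⟧), Triangle.mk f g h ∈ distTriang _ := by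
  let τ : TStructure (DerivedCategory A) := TStructure.t
  let N := (τ.truncGT (-1)).obj M
  have hN : τ.IsGE N 0 := τ.isGE_truncGT_obj _ _ _
  let Z := (τ.truncLE 0).obj N
  have hZ₀ : IsGE Z 0 := inferInstanceAs (τ.IsGE _ _)
  have hZ₁ : IsLE Z 0 := inferInstanceAs (τ.IsLE _ _)
  obtain ⟨B, ⟨e⟩⟩ := exists_iso_singleFunctor_obj_of_isGE_of_isLE Z 0
  obtain ⟨T, F, i, p, w, hT, hF, hS⟩ := t.exists_shortExact B
  have hS' := hS.singleTriangle_distinguished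
  let j : (singleFunctor A 0).obj T ⟶ Z := (singleFunctor A 0).map i ≫ e.inv
  have hj : Triangle.mk j (e.hom ≫ (singleFunctor A 0).map p) hS.singleδ ∈ distTriang _ :=
    isomorphic_distinguished _ hS' _ (Triangle.isoMk _ _ (Iso.refl _) e (Iso.refl _)
      (by
        change j ≫ e.hom = 𝟙 _ ≫ (singleFunctor A 0).map i
        simp [j])
      (by
        change (e.hom ≫ (singleFunctor A 0).map p) ≫ 𝟙 _ = e.hom ≫ (singleFunctor A 0).map p
        simp)
      (by
        change hS.singleδ ≫ (𝟙 ((singleFunctor A 0).obj T))⟦(1 : ℤ)⟧' = 𝟙 _ ≫ hS.singleδ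
        simp))
  have hZN := τ.triangleLEGT_distinguished 0 N
  obtain ⟨W, k, d, hW⟩ := distinguished_cocone_triangle (j ≫ (τ.truncLEι 0).app N)
  have o₁ := someOctahedron rfl hj hZN hW
  have hMN := τ.triangleLEGT_distinguished (-1) M
  obtain ⟨U, a, b, hU⟩ := distinguished_cocone_triangle₁ ((τ.truncGTπ (-1)).app M ≫ k)
  have o₂ := someOctahedron' rfl hMN hW hU
  have hN1 : IsGE ((τ.truncGT 0).obj N) 1 := τ.isGE_truncGT_obj _ _ _
  have hN0 : τ.IsGE ((τ.truncGT 0).obj N) 0 := τ.isGE_truncGT_obj _ _ _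
  have hM1 : IsLE ((τ.truncLE (-1)).obj M) (-1) := inferInstanceAs (τ.IsLE _ _)
  have hM0 : τ.IsLE ((τ.truncLE (-1)).obj M) 0 := τ.isLE_truncLE_obj _ _ _
  refine ⟨U, W, ⟨?_, ?_⟩, ⟨?_, ?_⟩, a, _, b, hU⟩
  · exact τ.isLE₂ _ o₂.mem 0 hM0 (inferInstanceAs (IsLE ((singleFunctor A 0).obj T) 0))
  · have h₁ : Mono ((homologyFunctor A 0).map o₂.m₃) :=
      mono_homologyMap_mor₂ _ o₂.mem 0 (isZero_of_isLE _ (-1) 0 (by lia) (hX := hM1))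
    have h₂ : Epi ((homologyFunctor A 0).map o₂.m₃) :=
      epi_homologyMap_mor₂ _ o₂.mem 0 1 rfl (isZero_of_isLE _ (-1) 1 (by lia) (hX := hM1))
    have := isIso_of_mono_of_epi ((homologyFunctor A 0).map o₂.m₃)
    exact t.torsion.prop_of_iso ((asIso ((homologyFunctor A 0).map o₂.m₃) ≪≫
      (singleFunctorCompHomologyFunctorIso A 0).app T).symm) hT
  · exact τ.isGE₂ _ o₁.mem 0 (inferInstanceAs (IsGE ((singleFunctor A 0).obj F) 0))
      hN0
  · have h₁ : Mono ((homologyFunctor A 0).map o₁.m₁) :=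
      mono_homologyMap_mor₁ _ o₁.mem (-1) 0 rfl (isZero_of_isGE _ 1 (-1) (by lia) (hX := hN1))
    have h₂ : Epi ((homologyFunctor A 0).map o₁.m₁) :=
      epi_homologyMap_mor₁ _ o₁.mem 0 (isZero_of_isGE _ 1 0 (by lia) (hX := hN1))
    have := isIso_of_mono_of_epi ((homologyFunctor A 0).map o₁.m₁)
    exact t.torsionFree.prop_of_iso ((singleFunctorCompHomologyFunctorIso A 0).symm.app F ≪≫
      asIso ((homologyFunctor A 0).map o₁.m₁)) hF

/-- The Happel-Reiten-Smalø t-structure on the derived category attached to a torsion pair `t`.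
Its aisle (`le 0`) is `U_t = {U ∈ D^{≤ 0} : H⁰(U) ∈ T}` and `ge 0` is
`V_t = {V ∈ D^{≥ -1} : H⁻¹(V) ∈ F}`. -/
noncomputable def hrsTStructure : TStructure (DerivedCategory A) where
  le := t.hrsLE
  ge := t.hrsGE
  le_isClosedUnderIsomorphisms n :=
    ⟨fun e h ↦ ⟨have := h.1; TStructure.t.isLE_of_iso e n,
      t.torsion.prop_of_iso ((homologyFunctor A n).mapIso e) h.2⟩⟩
  ge_isClosedUnderIsomorphisms n :=
    ⟨fun e h ↦ ⟨have := h.1; TStructure.t.isGE_of_iso e (n - 1),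
      t.torsionFree.prop_of_iso ((homologyFunctor A (n - 1)).mapIso e) h.2⟩⟩
  le_shift n a n' h X hX :=
    ⟨have := hX.1; TStructure.t.isLE_shift X n a n' h,
      t.torsion.prop_of_iso (homologyShiftIso X n a n' h).symm hX.2⟩
  ge_shift n a n' h X hX :=
    ⟨have := hX.1; TStructure.t.isGE_shift X (n - 1) a (n' - 1) (by lia),
      t.torsionFree.prop_of_iso
        (homologyShiftIso X (n - 1) a (n' - 1) (by lia)).symm hX.2⟩
  zero' X Y f hX hY :=
    eq_zero_of_homologyMap_eq_zero f hX.1 hY.1 (t.hom_eq_zero _ hX.2 hY.2)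
  le_zero_le X hX :=
    ⟨have := hX.1; TStructure.t.isLE_of_le X 0 1,
      have := hX.1; t.torsion_of_isZero (isZero_of_isLE X 0 1 (by lia))⟩
  ge_one_le X hX :=
    have : X.IsGE 0 := hX.1
    ⟨TStructure.t.isGE_of_ge X (0 - 1) 0,
      t.torsionFree_of_isZero (isZero_of_isGE X 0 (0 - 1) (by lia))⟩
  exists_triangle_zero_one := t.hrs_exists_triangle

end TorsionPair

/-- A Grothendieck category is locally finitely presented if it has a set of finitely presented
generators: every object is an epimorphic image of a coproduct of objects of this set. -/
class IsLocallyFinitelyPresented (G : Type u) [Category.{v} G] [Abelian G]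
    [IsGrothendieckAbelian.{v} G] : Prop where
  exists_generators (G) : ∃ (I : Type v) (s : I → G), (∀ i, IsFinitelyPresentable.{v} (s i)) ∧
    ∀ X : G, ∃ (J : Type v) (k : J → I) (p : (∐ fun j ↦ s (k j)) ⟶ X), Epi p

/-- A Grothendieck category is locally coherent if it is locally finitely presented and its
finitely presented objects are closed under kernels. -/
class IsLocallyCoherent (G : Type u) [Category.{v} G] [Abelian G]
    [IsGrothendieckAbelian.{v} G] : Prop extends IsLocallyFinitelyPresented G where
  isClosedUnderKernels :
    (ObjectProperty.isFinitelyPresentable.{v} G).IsClosedUnderKernels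

/-- A Grothendieck category is locally noetherian if it has a set of noetherian generators. -/
class IsLocallyNoetherian (G : Type u) [Category.{v} G] [Abelian G]
    [IsGrothendieckAbelian.{v} G] : Prop where
  exists_generators (G) : ∃ (I : Type v) (s : I → G), (∀ i, IsNoetherianObject (s i)) ∧
    ∀ X : G, ∃ (J : Type v) (k : J → I) (p : (∐ fun j ↦ s (k j)) ⟶ X), Epi p

attribute [instance] IsLocallyCoherent.isClosedUnderKernels

namespace IsLocallyCoherent

universe u'

variable {G : Type u} [Category.{v} G] [Abelian G] [IsGrothendieckAbelian.{v} G]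

lemma isFinitelyPresentable_of_isColimit {K : Type u'} [SmallCategory K] [FinCategory K]
    {Y : K ⥤ G} {c : Cocone Y} (hc : IsColimit c)
    (h : ∀ k, IsFinitelyPresentable.{v} (Y.obj k)) : IsFinitelyPresentable.{v} c.pt := by
  have := Cardinal.fact_isRegular_aleph0.{v}
  have hK : HasCardinalLT (Arrow K) Cardinal.aleph0.{v} := by
    rw [hasCardinalLT_aleph0_iff]
    infer_instance
  exact isCardinalPresentable_of_isColimit c hc _ hK

lemma isFinitelyPresentable_pushout {X Y Z : G} (f : X ⟶ Y) (g : X ⟶ Z)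
    (hX : IsFinitelyPresentable.{v} X)
    (hY : IsFinitelyPresentable.{v} Y) (hZ : IsFinitelyPresentable.{v} Z) :
    IsFinitelyPresentable.{v} (pushout f g) :=
  isFinitelyPresentable_of_isColimit (colimit.isColimit (span f g)) (by
    rintro (_ | _ | _)
    · exact hX
    · exact hY
    · exact hZ)

instance : (ObjectProperty.isFinitelyPresentable.{v} G).IsClosedUnderIsomorphisms where
  of_iso e hX := by
    have := Cardinal.fact_isRegular_aleph0.{v}
    have : IsFinitelyPresentable.{v} _ := hX
    exact isCardinalPresentable_of_iso e _

instance : (ObjectProperty.isFinitelyPresentable.{v} G).ContainsZero where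
  exists_zero := ⟨_, isZero_zero G,
    (isFinitelyPresentable_of_isColimit (Y := Functor.empty.{0} G) (c := asEmptyCocone 0)
      ((IsInitial.ofUniqueHom (fun _ ↦ 0) (fun _ _ ↦ (isZero_zero G).eq_of_src _ _)) : IsInitial (0 : G))
      (by rintro ⟨⟨⟩⟩) : IsFinitelyPresentable.{v} (0 : G))⟩

instance : (ObjectProperty.isFinitelyPresentable.{v} G).IsClosedUnderCokernels where
  cokernels_le := by
    rintro _ ⟨f, k, hk, hX, hY⟩
    exact isFinitelyPresentable_of_isColimit hk (by
      rintro (_ | _)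
      · exact hX
      · exact hY)

/-- If a family of morphisms to a finitely presentable object is jointly epimorphic, so is a
finite subfamily. -/
lemma exists_finset_epi {J : Type v} {Z : J → G} {C : G} (hC : IsFinitelyPresentable.{v} C)
    (f : ∀ j, Z j ⟶ C) (hf : Epi (Sigma.desc f)) :
    ∃ (I : Finset J), Epi (Sigma.desc (fun (i : I) ↦ f i.1)) := by
  classical
  let φ (I : Finset J) := Sigma.desc (fun (i : I) ↦ f i.1)
  have hφ {I I' : Finset J} (h : I ≤ I') : φ I ≫ cokernel.π (φ I') = 0 := by
    refine Sigma.hom_ext _ _ (fun i ↦ ?_)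
    have : f i.1 = Sigma.ι (fun (i : I') ↦ Z i.1) ⟨i.1, h i.2⟩ ≫ φ I' := by simp [φ]
    simp only [φ, Sigma.ι_desc_assoc, comp_zero]
    rw [this, Category.assoc, cokernel.condition, comp_zero]
  let D : Finset J ⥤ G :=
    { obj I := cokernel (φ I)
      map {I I'} h := cokernel.desc _ (cokernel.π (φ I')) (hφ (leOfHom h))
      map_id _ := by ext; simp
      map_comp _ _ := by ext; simp }
  let c : Cocone D := Cocone.mk 0 { app _ := 0 }
  have hc : IsColimit c :=
    { desc _ := 0
      fac s I := by
        have key (I I' : Finset J) : cokernel.π (φ I) ≫ s.ι.app I =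
            cokernel.π (φ I') ≫ s.ι.app I' := by
          have h₁ := s.w (homOfLE (le_sup_left : I ≤ I ⊔ I'))
          have h₂ := s.w (homOfLE (le_sup_right : I' ≤ I ⊔ I'))
          rw [← h₁, ← h₂]
          simp [D]
        have : cokernel.π (φ I) ≫ s.ι.app I = 0 := by
          rw [← cancel_epi (Sigma.desc f), comp_zero]
          refine Sigma.hom_ext _ _ (fun j ↦ ?_)
          rw [key I {j}]
          have : f j = Sigma.ι (fun (i : ({j} : Finset J)) ↦ Z i.1)
            ⟨j, Finset.mem_singleton_self j⟩ ≫ φ {j} := by simp [φ]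
          rw [Sigma.ι_desc_assoc, this, Category.assoc, cokernel.condition_assoc]
          simp
        change c.ι.app I ≫ 0 = s.ι.app I
        rw [comp_zero]
        symm
        rw [← cancel_epi (cokernel.π (φ I)), this, comp_zero]
      uniq _ _ _ := (isZero_zero G).eq_of_src _ _ }
  obtain ⟨I, u, v, h⟩ := IsFinitelyPresentable.exists_eq_of_isColimit hc (i := ∅) (j := ∅)
    (cokernel.π (φ ∅) : C ⟶ _) 0 ((isZero_zero G).eq_of_tgt _ _)
  refine ⟨I, Preadditive.epi_of_cokernel_zero (f := φ I) ?_⟩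
  simpa [D] using h

instance [IsLocallyCoherent G] :
    (ObjectProperty.isFinitelyPresentable.{v} G).IsClosedUnderExtensions where
  prop_X₂_of_shortExact {S} hS h₁ h₃ := by
    have := hS.mono_f
    have := hS.epi_g
    obtain ⟨I, s, hs, hgen⟩ := IsLocallyFinitelyPresented.exists_generators G
    obtain ⟨J, k, p, hp⟩ := hgen S.X₂
    let f (j : J) : s (k j) ⟶ S.X₃ := Sigma.ι (fun j ↦ s (k j)) j ≫ p ≫ S.g
    have hf : Sigma.desc f = p ≫ S.g := Sigma.hom_ext _ _ (by simp [f])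
    obtain ⟨I₀, hI₀⟩ := exists_finset_epi h₃ f (by rw [hf]; infer_instance)
    have hP : IsFinitelyPresentable.{v} (∐ fun (i : I₀) ↦ s (k i.1)) :=
      isFinitelyPresentable_of_isColimit (colimit.isColimit _) (fun i ↦ hs _)
    let q : (∐ fun (i : I₀) ↦ s (k i.1)) ⟶ S.X₂ :=
      Sigma.desc (fun i ↦ Sigma.ι (fun j ↦ s (k j)) i.1 ≫ p)
    have hq : q ≫ S.g = Sigma.desc (fun (i : I₀) ↦ f i.1) := Sigma.hom_ext _ _ (by simp [q, f])
    have hqg : Epi (q ≫ S.g) := by rw [hq]; exact hI₀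
    have hpb := IsPullback.of_hasPullback S.f q
    have w : pullback.snd S.f q ≫ q ≫ S.g = 0 := by
      rw [← pullback.condition_assoc, S.zero, comp_zero]
    have hker : IsLimit (KernelFork.ofι _ w) := KernelFork.IsLimit.ofι' _ _ (fun {T} x hx ↦
      ⟨pullback.lift (hS.exact.lift (x ≫ q) (by rw [Category.assoc]; exact hx)) x
        (hS.exact.lift_f _ _), pullback.lift_snd _ _ _⟩)
    have hK : IsFinitelyPresentable.{v} (pullback S.f q) :=
      (ObjectProperty.isFinitelyPresentable.{v} G).prop_of_isLimit_kernelFork hker hP h₃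
    have hQ := isFinitelyPresentable_pushout (pullback.fst S.f q) (pullback.snd S.f q) hK h₁ hP
    let d : pushout (pullback.fst S.f q) (pullback.snd S.f q) ⟶ S.X₂ :=
      pushout.desc S.f q pullback.condition
    have hd₁ : Mono d := (IsPushout.of_hasPushout _ _).mono_of_isPullback_of_mono hpb d
      (pushout.inl_desc _ _ _) (pushout.inr_desc _ _ _)
    have hd₂ : Epi d := by
      rw [Preadditive.epi_iff_cancel_zero]
      intro T x hx
      have hx₁ : S.f ≫ x = 0 := by
        rw [← pushout.inl_desc S.f q pullback.condition, Category.assoc, hx, comp_zero]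
      have hx₂ : q ≫ x = 0 := by
        rw [← pushout.inr_desc S.f q pullback.condition, Category.assoc, hx, comp_zero]
      obtain ⟨y, rfl⟩ : ∃ y, x = S.g ≫ y := ⟨hS.exact.desc x hx₁, by simp⟩
      rw [← Category.assoc] at hx₂
      rw [(cancel_epi (q ≫ S.g)).1 (hx₂.trans comp_zero.symm), comp_zero]
    have := isIso_of_mono_of_epi d
    exact (ObjectProperty.isFinitelyPresentable.{v} G).prop_of_iso (asIso d) hQ

end IsLocallyCoherent

section

variable (G : Type u) [Category.{v} G] [Abelian G] [IsGrothendieckAbelian.{v} G]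
  [HasDerivedCategory.{w} G]

/-- The bounded derived category `D^b(fp(G))`, viewed as the full subcategory of `D(G)` of the
complexes with bounded cohomology whose cohomology objects are all finitely presented. -/
def boundedFP : ObjectProperty (DerivedCategory G) := fun X ↦
  DerivedCategory.TStructure.t.bounded X ∧
    ∀ i : ℤ, IsFinitelyPresentable.{v} ((DerivedCategory.homologyFunctor G i).obj X)

instance : (boundedFP G).IsClosedUnderIsomorphisms where
  of_iso e h := ⟨ObjectProperty.prop_of_iso _ e h.1, fun i ↦
    (ObjectProperty.isFinitelyPresentable.{v} G).prop_of_iso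
      ((DerivedCategory.homologyFunctor G i).mapIso e) (h.2 i)⟩

/-- When `G` is locally coherent, `D^b(fp(G))` is a triangulated subcategory of `D(G)`. -/
instance [IsLocallyCoherent G] : (boundedFP G).IsTriangulated where
  exists_zero := ⟨0, isZero_zero _, ObjectProperty.prop_zero _, fun i ↦
    (ObjectProperty.isFinitelyPresentable.{v} G).prop_of_isZero
      (Functor.map_isZero _ (isZero_zero _))⟩
  isStableUnderShiftBy a :=
    { le_shift X hX := ⟨ObjectProperty.le_shift _ a _ hX.1, fun i ↦
        (ObjectProperty.isFinitelyPresentable.{v} G).prop_of_iso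
          (DerivedCategory.homologyShiftIso X (a + i) a i rfl).symm (hX.2 _)⟩ }
  toIsTriangulatedClosed₂ := .mk' (fun T hT h₁ h₃ ↦
    ⟨ObjectProperty.ext_of_isTriangulatedClosed₂ _ T hT h₁.1 h₃.1, fun i ↦ by
      let P := ObjectProperty.isFinitelyPresentable.{v} G
      let F := DerivedCategory.homologyFunctor G
      have e₁ := DerivedCategory.HomologySequence.exact₁ T hT (i - 1) i (by lia)
      have e₂ := DerivedCategory.HomologySequence.exact₂ T hT i
      have e₃ := DerivedCategory.HomologySequence.exact₃ T hT i (i + 1) rfl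
      let δ₁ := DerivedCategory.HomologySequence.δ T (i - 1) i (by lia)
      let δ₂ := DerivedCategory.HomologySequence.δ T i (i + 1) rfl
      let a : cokernel δ₁ ⟶ (F i).obj T.obj₂ := cokernel.desc _ ((F i).map T.mor₁)
        (DerivedCategory.HomologySequence.δ_comp T hT (i - 1) i (by lia))
      let b : (F i).obj T.obj₂ ⟶ kernel δ₂ := kernel.lift _ ((F i).map T.mor₂)
        (DerivedCategory.HomologySequence.comp_δ T hT i (i + 1) rfl)
      have ha : Mono a := e₁.mono_cokernelDesc
      have hb : Epi b := e₃.epi_kernelLift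
      have wb : (F i).map T.mor₁ ≫ b = 0 := by
        rw [← cancel_mono (kernel.ι δ₂)]
        simp only [b, Category.assoc, kernel.lift_ι, zero_comp]
        rw [← Functor.map_comp, comp_distTriang_mor_zero₁₂ _ hT, Functor.map_zero]
      have w : a ≫ b = 0 := by
        rw [← cancel_epi (cokernel.π δ₁), cokernel.π_desc_assoc, wb, comp_zero]
      let φ₁ : ShortComplex.mk _ _ wb ⟶ ShortComplex.mk a b w :=
        { τ₁ := cokernel.π δ₁
          τ₂ := 𝟙 _
          τ₃ := 𝟙 _
          comm₁₂ := by simp [a]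
          comm₂₃ := by simp }
      let φ₂ : ShortComplex.mk _ _ wb ⟶ ShortComplex.mk ((F i).map T.mor₁) ((F i).map T.mor₂)
          (by rw [← Functor.map_comp, comp_distTriang_mor_zero₁₂ _ hT, Functor.map_zero]) :=
        { τ₁ := 𝟙 _
          τ₂ := 𝟙 _
          τ₃ := kernel.ι δ₂
          comm₁₂ := by simp
          comm₂₃ := by simp [b] }
      have : Epi φ₁.τ₁ := inferInstanceAs (Epi (cokernel.π δ₁))
      have : IsIso φ₁.τ₂ := inferInstanceAs (IsIso (𝟙 _))
      have : Mono φ₁.τ₃ := inferInstanceAs (Mono (𝟙 _))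
      have : Epi φ₂.τ₁ := inferInstanceAs (Epi (𝟙 _))
      have : IsIso φ₂.τ₂ := inferInstanceAs (IsIso (𝟙 _))
      have : Mono φ₂.τ₃ := inferInstanceAs (Mono (kernel.ι δ₂))
      have hS : (ShortComplex.mk a b w).ShortExact :=
        { exact := (ShortComplex.exact_iff_of_epi_of_isIso_of_mono φ₁).1
            ((ShortComplex.exact_iff_of_epi_of_isIso_of_mono φ₂).2 e₂) }
      exact P.prop_X₂_of_shortExact hS (P.prop_cokernel _ (h₃.2 _) (h₁.2 _))
        (P.prop_kernel _ (h₃.2 _) (h₁.2 _))⟩)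

/-- A t-structure `τ` on `D(G)` restricts to the triangulated subcategory `D^b(fp(G))`: every object
of `D^b(fp(G))` has a truncation triangle for `τ` whose vertices lie in `D^b(fp(G))`. Equivalently,
the intersections of `τ` with `D^b(fp(G))` form a t-structure on `D^b(fp(G))`, see
`CategoryTheory.ObjectProperty.tStructure`. -/
def RestrictsToBoundedFP [IsLocallyCoherent G] (τ : TStructure (DerivedCategory G)) : Prop :=
  (boundedFP G).HasInducedTStructure τ

end

/-! Let `U ⟶ M ⟶ V` be the HRS truncation triangle of `M`, with `U` in the aisle and `V` in `D^{≥
0}` with `H⁰(V)` torsion-free. The long exact sequence computes the cohomology of `U`: it is that of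
`M` in negative degrees, the torsion part of `H⁰(M)` in degree 0, and zero above. So for `M` in
`D^b(fp(G))`, the vertex `U` lies there as soon as `t(H⁰(M))` is finitely presented
(`boundedFP_obj₁`), and `V` follows because coherence makes `D^b(fp(G))` triangulated. Conversely,
truncating an object `X` placed in degree 0 exhibits `t(X)` as `H⁰(U)`.

In the locally noetherian case, finitely presented and noetherian objects coincide. Since `t(X)` is
a subobject of `X` and subobjects of noetherian objects are noetherian, every torsion pair
restricts. The two inclusions rest on the closure of noetherian objects under quotients and
extensions, and on the extraction of finite jointly epimorphic subfamilies. -/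

namespace CategoryTheory.Subobject

/-! ### Comparing subobjects by generalised elements. -/

variable {A : Type u} [Category.{v} A] [Abelian A]

/-- Membership in `S` is the vanishing of the composite with `cokernel.π S.arrow`, which can be
tested after an epimorphism. This permits element chases up to refinement. -/
lemma factors_of_epi {X Y Z : A} (S : Subobject Z) (p : X ⟶ Y) [Epi p] (f : Y ⟶ Z)
    (h : S.Factors (p ≫ f)) : S.Factors f := by
  have h₀ : f ≫ cokernel.π S.arrow = 0 := by
    rw [← cancel_epi p, ← Category.assoc, ← S.factorThru_arrow _ h, Category.assoc,
      cokernel.condition, comp_zero, comp_zero]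
  exact (S.factors_iff _).2 ⟨Abelian.monoLift S.arrow f h₀, Abelian.monoLift_comp S.arrow f h₀⟩

lemma factors_pullback_iff {X Y Z : A} (f : X ⟶ Y) (S : Subobject Y) (z : Z ⟶ X) :
    ((pullback f).obj S).Factors z ↔ S.Factors (z ≫ f) := by
  have h := isPullback f S
  constructor
  · intro hz
    rw [← factorThru_arrow _ z hz, Category.assoc, ← h.w, ← Category.assoc]
    exact factors_comp_arrow _
  · intro hz
    have : z = h.lift (S.factorThru _ hz) z (factorThru_arrow _ _ _) ≫
        ((pullback f).obj S).arrow := (h.lift_snd _ _ _).symm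
    rw [this]
    exact factors_comp_arrow _

/-- Generalised elements of `Y` lift to `X` after refinement, so a subobject is recovered from its
inverse image. Strictness is what transfers the ascending chain condition to quotients. -/
lemma pullback_strictMono_of_epi {X Y : A} (f : X ⟶ Y) [Epi f] :
    StrictMono (pullback f).obj := by
  refine (pullback f).monotone.strictMono_of_injective (fun S S' h ↦ ?_)
  have key {S S' : Subobject Y} (h : (pullback f).obj S = (pullback f).obj S') : S ≤ S' := by
    obtain ⟨Z, π, hπ, x, hx⟩ := surjective_up_to_refinements_of_epi f S.arrow
    refine le_of_factors (S'.factors_of_epi π _ ?_)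
    rw [hx, ← factors_pullback_iff, ← h, factors_pullback_iff, ← hx]
    exact factors_comp_arrow _
  exact le_antisymm (key h) (key h.symm)

/-- In a short exact sequence, a subobject of the middle term is determined, among those containing
a given subobject, by its inverse image in the left term and its image in the right term. -/
lemma le_of_shortExact {E : ShortComplex A} (hE : E.ShortExact) {S S' : Subobject E.X₂}
    (h : S ≤ S') (h₁ : (pullback E.f).obj S' ≤ (pullback E.f).obj S)
    (h₂ : imageSubobject (S'.arrow ≫ E.g) ≤ imageSubobject (S.arrow ≫ E.g)) : S' ≤ S := by
  -- By `h₂`, the generic element of `S'` has, after refinement, the same image in `E.X₃` as an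
  -- element of `S`; their difference then comes from some `y` in `E.X₁`.
  obtain ⟨Z, π, hπ, x, hx⟩ := surjective_up_to_refinements_of_epi
    (factorThruImageSubobject (S.arrow ≫ E.g))
    (factorThruImageSubobject (S'.arrow ≫ E.g) ≫ ofLE _ _ h₂)
  replace hx := hx =≫ (imageSubobject _).arrow
  simp only [Category.assoc, ofLE_arrow, imageSubobject_arrow_comp] at hx
  obtain ⟨Z', π', hπ', y, hy⟩ := hE.exact.exact_up_to_refinements
    (π ≫ S'.arrow - x ≫ S.arrow) (by simp [hx])
  refine le_of_factors (S.factors_of_epi (π' ≫ π) _ ?_)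
  have hy' : (π' ≫ π) ≫ S'.arrow = y ≫ E.f + (π' ≫ x) ≫ S.arrow := by
    rw [← hy]
    simp
  rw [hy']
  refine factors_add _ _ ?_ (factors_comp_arrow _)
  rw [← factors_pullback_iff]
  -- `y ≫ E.f` is a difference of elements of `S'`, so `y` lies in the inverse image of `S'`, hence
  -- in that of `S`.
  refine factors_of_le _ h₁ ?_
  rw [factors_pullback_iff, ← hy, Preadditive.comp_sub, ← Category.assoc, ← Category.assoc,
    sub_eq_add_neg, ← Preadditive.neg_comp]
  exact factors_add _ _ (factors_comp_arrow _) (factors_of_le _ h (factors_comp_arrow _))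

end CategoryTheory.Subobject

/-! ### Closure properties of noetherian objects. -/

section Noetherian

variable {A : Type u} [Category.{v} A] [Abelian A]

lemma isNoetherianObject_of_epi {X Y : A} (f : X ⟶ Y) [Epi f] [IsNoetherianObject X] :
    IsNoetherianObject Y :=
  ⟨(Subobject.pullback_strictMono_of_epi f).wellFoundedGT⟩

instance : (isNoetherianObject (C := A)).IsClosedUnderExtensions where
  prop_X₂_of_shortExact {E} hE h₁ h₃ := by
    have : WellFoundedGT (Subobject E.X₁) := h₁
    have : WellFoundedGT (Subobject E.X₃) := h₃
    -- This map need not be injective, as incomparable subobjects can share both invariants. Strict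
    -- monotonicity into a product of two orders with the ascending chain condition is enough.
    have hφ : StrictMono (fun S : Subobject E.X₂ ↦
        ((Subobject.pullback E.f).obj S, imageSubobject (S.arrow ≫ E.g))) := by
      have hmono {S S' : Subobject E.X₂} (h : S ≤ S') :
          imageSubobject (S.arrow ≫ E.g) ≤ imageSubobject (S'.arrow ≫ E.g) :=
        imageSubobject_le _ (Subobject.ofLE _ _ h ≫ factorThruImageSubobject _) (by simp)
      intro S S' h
      refine lt_of_le_not_ge ⟨(Subobject.pullback E.f).monotone h.le, hmono h.le⟩ (fun h' ↦ ?_)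
      exact h.not_ge (Subobject.le_of_shortExact hE h.le h'.1 h'.2)
    exact hφ.wellFoundedGT

instance : (isNoetherianObject (C := A)).IsClosedUnderIsomorphisms where
  of_iso e h := by
    have : IsNoetherianObject _ := ⟨h⟩
    exact (isNoetherianObject_of_mono e.inv).prop

instance : (isNoetherianObject (C := A)).IsClosedUnderBinaryCoproducts where
  colimitsOfShape_le := by
    rintro X ⟨p⟩
    let P := isNoetherianObject (C := A)
    refine P.prop_of_iso ?_ (P.prop_biprod (p.prop_diag_obj (.mk .left))
      (p.prop_diag_obj (.mk .right)))
    exact biprod.isoCoprod _ _ ≪≫ IsColimit.coconePointUniqueUpToIso (coprodIsCoprod _ _)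
      ((IsColimit.precomposeHomEquiv (diagramIsoPair p.diag).symm _).2 p.isColimit)

instance : (isNoetherianObject (C := A)).IsClosedUnderFiniteCoproducts := .mk'

/-- If a family of morphisms to a noetherian object is jointly epimorphic, so is a finite
subfamily. -/
lemma exists_finset_epi_of_isNoetherianObject [HasCoproducts.{v} A] {J : Type v} {Z : J → A} {Y : A}
    [IsNoetherianObject Y] (f : ∀ j, Z j ⟶ Y) (hf : Epi (Sigma.desc f)) :
    ∃ (I : Finset J), Epi (Sigma.desc (fun (i : I) ↦ f i.1)) := by
  classical
  let φ (I : Finset J) := Sigma.desc (fun (i : I) ↦ f i.1)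
  have hφ {I I' : Finset J} (h : I ≤ I') : imageSubobject (φ I) ≤ imageSubobject (φ I') :=
    imageSubobject_le _ (Sigma.desc (fun i ↦ Sigma.ι (fun (i : I') ↦ Z i.1) ⟨i.1, h i.2⟩) ≫
      factorThruImageSubobject _) (Sigma.hom_ext _ _ (by simp [φ]))
  -- A minimum for `>` is a maximal image. Adjoining any `j` to this `I` cannot enlarge the image,
  -- so whatever kills `φ I` also kills `f j`.
  obtain ⟨_, ⟨I, rfl⟩, hI⟩ := WellFounded.has_min (wellFounded_gt (α := Subobject Y))
    (Set.range fun I ↦ imageSubobject (φ I)) ⟨_, ∅, rfl⟩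
  refine ⟨I, Preadditive.epi_of_cancel_zero _ (fun {T} x hx ↦ ?_)⟩
  rw [← cancel_epi (Sigma.desc f), comp_zero]
  refine Sigma.hom_ext _ _ (fun j ↦ ?_)
  have hle : imageSubobject (φ (insert j I)) ≤ imageSubobject (φ I) := by
    by_contra h
    exact hI _ ⟨insert j I, rfl⟩ (lt_of_le_not_ge (hφ (Finset.subset_insert j I)) h)
  have h₀ : φ (insert j I) ≫ x = 0 := by
    rw [← imageSubobject_arrow_comp (φ (insert j I)), ← Subobject.ofLE_arrow hle,
      Category.assoc, Category.assoc, imageSubobject_arrow_comp_eq_zero hx]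
    simp
  have hj : f j = Sigma.ι (fun (i : (insert j I : Finset J)) ↦ Z i.1)
    ⟨j, Finset.mem_insert_self j I⟩ ≫ φ (insert j I) := by simp [φ]
  rw [Sigma.ι_desc_assoc, hj, Category.assoc, h₀]
  simp

end Noetherian

/-! ### Noetherian versus finitely presented objects. -/

section

variable {G : Type u} [Category.{v} G] [Abelian G] [IsGrothendieckAbelian.{v} G]

/-- By finite presentability, finitely many noetherian generators already cover `X`, which is thus a
quotient of a noetherian object. -/
lemma IsLocallyNoetherian.isNoetherianObject_of_isFinitelyPresentable [IsLocallyNoetherian G]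
    {X : G} (hX : IsFinitelyPresentable.{v} X) : IsNoetherianObject X := by
  obtain ⟨I, s, hs, hgen⟩ := IsLocallyNoetherian.exists_generators G
  obtain ⟨J, k, p, hp⟩ := hgen X
  let f (j : J) : s (k j) ⟶ X := Sigma.ι (fun j ↦ s (k j)) j ≫ p
  have hf : Sigma.desc f = p := Sigma.hom_ext _ _ (by simp [f])
  obtain ⟨I₀, hI₀⟩ := IsLocallyCoherent.exists_finset_epi hX f (by rwa [hf])
  have : IsNoetherianObject (∐ fun (i : I₀) ↦ s (k i.1)) :=
    ⟨isNoetherianObject.prop_coproduct (fun i ↦ (hs _).prop)⟩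
  exact isNoetherianObject_of_epi (Sigma.desc (fun (i : I₀) ↦ f i.1))

/-- Here the finite subcover of generators comes from the chain condition on `Y`. -/
lemma IsLocallyFinitelyPresented.exists_epi_of_isNoetherianObject [IsLocallyFinitelyPresented G]
    (Y : G) [IsNoetherianObject Y] :
    ∃ (P : G) (p : P ⟶ Y), IsFinitelyPresentable.{v} P ∧ Epi p := by
  obtain ⟨I, s, hs, hgen⟩ := IsLocallyFinitelyPresented.exists_generators G
  obtain ⟨J, k, p, hp⟩ := hgen Y
  let f (j : J) : s (k j) ⟶ Y := Sigma.ι (fun j ↦ s (k j)) j ≫ p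
  have hf : Sigma.desc f = p := Sigma.hom_ext _ _ (by simp [f])
  obtain ⟨I₀, hI₀⟩ := exists_finset_epi_of_isNoetherianObject f (by rwa [hf])
  exact ⟨_, _, IsLocallyCoherent.isFinitelyPresentable_of_isColimit (colimit.isColimit _)
    (fun i ↦ hs _), hI₀⟩

lemma IsLocallyNoetherian.isFinitelyPresentable_of_isNoetherianObject
    [IsLocallyFinitelyPresented G] [IsLocallyNoetherian G] (Y : G) [IsNoetherianObject Y] :
    IsFinitelyPresentable.{v} Y := by
  obtain ⟨P, p, hP, _⟩ := IsLocallyFinitelyPresented.exists_epi_of_isNoetherianObject Y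
  -- `P` is noetherian, so `kernel p` is too and is covered by a finitely presented `Q`. This
  -- presents `Y` as the cokernel of `Q ⟶ P`.
  have := IsLocallyNoetherian.isNoetherianObject_of_isFinitelyPresentable hP
  have := isNoetherianObject_of_mono (kernel.ι p)
  obtain ⟨Q, q, hQ, _⟩ := IsLocallyFinitelyPresented.exists_epi_of_isNoetherianObject (kernel p)
  have hc : IsColimit (CokernelCofork.ofπ (f := q ≫ kernel.ι p) p (by simp)) :=
    isCokernelEpiComp (Abelian.epiIsCokernelOfKernel _ (kernelIsKernel p)) q rfl
  exact IsLocallyCoherent.isFinitelyPresentable_of_isColimit hc (by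
    rintro (_ | _)
    · exact hQ
    · exact hP)

end

/-! ### Uniqueness of the torsion part. -/

namespace TorsionPair

section

variable {A : Type u} [Category.{v} A] [Abelian A] (t : TorsionPair A)

/-- As `Hom(T, F) = 0`, each torsion subobject factors through the other. Since `radical` is a mere
choice, this is what identifies it with torsion parts arising elsewhere. -/
lemma nonempty_iso_of_shortExact {X T F T' F' : A} {i : T ⟶ X} {p : X ⟶ F} {w : i ≫ p = 0}
    {i' : T' ⟶ X} {p' : X ⟶ F'} {w' : i' ≫ p' = 0} (hT : t.torsion T) (hF : t.torsionFree F)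
    (hT' : t.torsion T') (hF' : t.torsionFree F') (h : (ShortComplex.mk i p w).ShortExact)
    (h' : (ShortComplex.mk i' p' w').ShortExact) : Nonempty (T ≅ T') := by
  have : Mono i := h.mono_f
  have : Mono i' := h'.mono_f
  obtain ⟨a, ha⟩ : ∃ a, a ≫ i' = i :=
    ⟨_, h'.exact.lift_f i (t.hom_eq_zero _ hT hF')⟩
  obtain ⟨b, hb⟩ : ∃ b, b ≫ i = i' :=
    ⟨_, h.exact.lift_f i' (t.hom_eq_zero _ hT' hF)⟩
  exact ⟨⟨a, b, by simp [← cancel_mono i, ha, hb], by simp [← cancel_mono i', ha, hb]⟩⟩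

lemma exists_shortExact_radical (X : A) :
    ∃ (F : A) (i : t.radical X ⟶ X) (p : X ⟶ F) (w : i ≫ p = 0),
      t.torsion (t.radical X) ∧ t.torsionFree F ∧ (ShortComplex.mk i p w).ShortExact :=
  (t.exists_shortExact X).choose_spec

lemma nonempty_radical_iso {X T F : A} {i : T ⟶ X} {p : X ⟶ F} {w : i ≫ p = 0}
    (hT : t.torsion T) (hF : t.torsionFree F) (h : (ShortComplex.mk i p w).ShortExact) :
    Nonempty (t.radical X ≅ T) := by
  obtain ⟨F', i', p', w', hT', hF', h'⟩ := t.exists_shortExact_radical X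
  exact t.nonempty_iso_of_shortExact hT' hF' hT hF h' h

lemma nonempty_radical_iso_of_iso {X Y : A} (e : X ≅ Y) :
    Nonempty (t.radical X ≅ t.radical Y) := by
  obtain ⟨F, i, p, w, hT, hF, h⟩ := t.exists_shortExact_radical Y
  refine t.nonempty_radical_iso (i := i ≫ e.inv) (p := e.hom ≫ p) (w := by simp [w]) hT hF ?_
  have φ : ShortComplex.mk i p w ≅ ShortComplex.mk (i ≫ e.inv) (e.hom ≫ p) (by simp [w]) :=
    ShortComplex.isoMk (Iso.refl _) e.symm (Iso.refl _) (by simp) (by simp)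
  exact ShortComplex.shortExact_of_iso φ h

lemma exists_mono_radical (X : A) : ∃ i : t.radical X ⟶ X, Mono i := by
  obtain ⟨F, i, p, w, -, -, h⟩ := t.exists_shortExact_radical X
  exact ⟨i, h.mono_f⟩

end

/-! ### Cohomology of HRS truncation triangles. -/

section

variable {A : Type u} [Category.{v} A] [Abelian A] [HasDerivedCategory.{w} A] (t : TorsionPair A)

open DerivedCategory

/-- If `X ⟶ M ⟶ Y` is a truncation triangle for the HRS t-structure, then `H⁰(X)` is the torsion
part of `H⁰(M)`. -/
lemma nonempty_radical_homology_iso (T : Triangle (DerivedCategory A)) (hT : T ∈ distTriang _)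
    (h₁ : t.hrsLE 0 T.obj₁) (h₃ : t.hrsGE 1 T.obj₃) :
    Nonempty (t.radical ((homologyFunctor A 0).obj T.obj₂) ≅
      (homologyFunctor A 0).obj T.obj₁) := by
  have := h₁.1
  -- `hrsGE 1` bounds cohomology below by `1 - 1`. So `H⁻¹` of the third vertex vanishes, giving the
  -- monomorphism below, and `H¹` of the first vanishes, giving the epimorphism.
  have : IsGE T.obj₃ 0 := h₃.1
  have hm := mono_homologyMap_mor₁ T hT (-1) 0 rfl (isZero_of_isGE _ 0 (-1) (by lia))
  have he := epi_homologyMap_mor₂ T hT 0 1 rfl (isZero_of_isLE _ 0 1 (by lia))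
  exact t.nonempty_radical_iso h₁.2 h₃.2 { exact := HomologySequence.exact₂ T hT 0 }

lemma nonempty_homology_iso_of_neg (T : Triangle (DerivedCategory A)) (hT : T ∈ distTriang _)
    (h₃ : IsGE T.obj₃ 0) (n : ℤ) (hn : n < 0) :
    Nonempty ((homologyFunctor A n).obj T.obj₁ ≅ (homologyFunctor A n).obj T.obj₂) := by
  have hm := mono_homologyMap_mor₁ T hT (n - 1) n (by lia) (isZero_of_isGE _ 0 (n - 1) (by lia))
  have he := epi_homologyMap_mor₁ T hT n (isZero_of_isGE _ 0 n (by lia))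
  have := isIso_of_mono_of_epi ((homologyFunctor A n).map T.mor₁)
  exact ⟨asIso ((homologyFunctor A n).map T.mor₁)⟩

end

/-! ### Restriction to finitely presented objects and to `D^b(fp(G))`. -/

variable {G : Type u} [Category.{v} G] [Abelian G] [IsGrothendieckAbelian.{v} G] (t : TorsionPair G)

lemma restrictsToFP_of_isLocallyNoetherian [IsLocallyFinitelyPresented G]
    [IsLocallyNoetherian G] : t.RestrictsToFP := by
  intro X hX
  have := IsLocallyNoetherian.isNoetherianObject_of_isFinitelyPresentable hX
  obtain ⟨i, _⟩ := t.exists_mono_radical X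
  have := isNoetherianObject_of_mono i
  exact IsLocallyNoetherian.isFinitelyPresentable_of_isNoetherianObject _

open DerivedCategory

variable [HasDerivedCategory.{w} G]

lemma boundedFP_singleFunctor_obj {X : G} (hX : IsFinitelyPresentable.{v} X) :
    boundedFP G ((singleFunctor G 0).obj X) := by
  let P := ObjectProperty.isFinitelyPresentable.{v} G
  refine ⟨⟨⟨0, inferInstanceAs (IsGE _ 0)⟩, ⟨0, inferInstanceAs (IsLE _ 0)⟩⟩, fun i ↦ ?_⟩
  obtain hi | rfl | hi := lt_trichotomy i 0
  · exact P.prop_of_isZero (isZero_of_isGE _ 0 i hi)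
  · exact P.prop_of_iso ((singleFunctorCompHomologyFunctorIso G 0).symm.app X) hX
  · exact P.prop_of_isZero (isZero_of_isLE _ 0 i hi)

lemma boundedFP_obj₁ (h : t.RestrictsToFP) (T : Triangle (DerivedCategory G))
    (hT : T ∈ distTriang _) (h₁ : t.hrsLE 0 T.obj₁) (h₃ : t.hrsGE 1 T.obj₃)
    (h₂ : boundedFP G T.obj₂) : boundedFP G T.obj₁ := by
  let P := ObjectProperty.isFinitelyPresentable.{v} G
  have h₃' : IsGE T.obj₃ 0 := h₃.1
  have h₁' := h₁.1
  obtain ⟨⟨⟨n, hn⟩, -⟩, hM⟩ := h₂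
  have hn' : IsGE T.obj₂ n := hn
  -- Below `min n 0` the degree is negative, so the cohomology agrees with that of `T.obj₂`, and it
  -- is below the bound `n`, so the latter vanishes.
  refine ⟨⟨⟨min n 0, (isGE_iff _ _).2 (fun i hi ↦ ?_)⟩, ⟨0, h₁'⟩⟩, fun i ↦ ?_⟩
  · obtain ⟨e⟩ := nonempty_homology_iso_of_neg T hT h₃' i (by lia)
    exact (isZero_of_isGE T.obj₂ n i (by lia)).of_iso e
  · obtain hi | rfl | hi := lt_trichotomy i 0
    · obtain ⟨e⟩ := nonempty_homology_iso_of_neg T hT h₃' i hi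
      exact P.prop_of_iso e.symm (hM i)
    · obtain ⟨e⟩ := t.nonempty_radical_homology_iso T hT h₁ h₃
      exact P.prop_of_iso e (h _ (hM 0))
    · exact P.prop_of_isZero (isZero_of_isLE _ 0 i hi)

variable [IsLocallyCoherent G]

lemma restrictsToFP_of_restrictsToBoundedFP (h : RestrictsToBoundedFP G t.hrsTStructure) :
    t.RestrictsToFP := by
  intro X hX
  obtain ⟨U, V, hU, hV, f, g, δ, hT, hU', -⟩ :=
    h.exists_triangle_zero_one _ (boundedFP_singleFunctor_obj hX)
  rw [ObjectProperty.isoClosure_eq_self] at hU'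
  obtain ⟨e⟩ := t.nonempty_radical_homology_iso _ hT hU.le hV.ge
  obtain ⟨e'⟩ := t.nonempty_radical_iso_of_iso
    ((singleFunctorCompHomologyFunctorIso G 0).app X)
  exact (ObjectProperty.isFinitelyPresentable.{v} G).prop_of_iso (e.symm ≪≫ e') (hU'.2 0)

lemma restrictsToBoundedFP_of_restrictsToFP (h : t.RestrictsToFP) :
    RestrictsToBoundedFP G t.hrsTStructure where
  exists_triangle_zero_one M hM := by
    obtain ⟨U, V, hU, hV, f, g, δ, hT⟩ := t.hrs_exists_triangle M
    have hU' := t.boundedFP_obj₁ h _ hT hU hV hM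
    -- Two out of three in the triangulated subcategory gives the membership of `V`; no cohomology
    -- of `V` need be computed.
    exact ⟨U, V, ⟨hU⟩, ⟨hV⟩, f, g, δ, hT, ObjectProperty.le_isoClosure _ _ hU',
      ObjectProperty.le_isoClosure _ _
        ((boundedFP G).ext_of_isTriangulatedClosed₃ _ hT hU' hM)⟩

end TorsionPair

theorem mainTheorem6 {G : Type u} [Category.{v} G] [Abelian G] [IsGrothendieckAbelian.{v} G]
    [IsLocallyCoherent G] [HasDerivedCategory.{w} G] (t : TorsionPair G) :
    (RestrictsToBoundedFP G t.hrsTStructure ↔ t.RestrictsToFP) ∧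
      (IsLocallyNoetherian G → RestrictsToBoundedFP G t.hrsTStructure) :=
  ⟨⟨t.restrictsToFP_of_restrictsToBoundedFP, t.restrictsToBoundedFP_of_restrictsToFP⟩,
    fun _ ↦ t.restrictsToBoundedFP_of_restrictsToFP t.restrictsToFP_of_isLocallyNoetherian⟩
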